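/- Let $H\in(0,\tfrac12)\cup(\tfrac12,1)$ and $\theta>0$. Let $S^H=\{S^H_t,\ t\ge 0\}$ be a sub-fractional Brownian motion with parameter $H$, i.e. a centered Gaussian process with covariance $$E\left(S^H_tS^H_s\right)=t^{2H}+s^{2H}-\tfrac12\left((t+s)^{2H}+|t-s|^{2H}\right),\qquad s,t\ge 0,$$ and let $X=\{X_t,\ t\ge0\}$ be the Ornstein–Uhlenbeck process driven by $S^H$, i.e. the continuous solution of $X_0=0$, $dX_t=-\theta X_t\,dt+dS^H_t$; that is, almost surely, $X_t=-\theta\int_0^tX_r\,dr+S^H_t$ for all $t\ge 0$. The increments of the driving process $S^H$ are not stationary, that is, it is not the case that for every $s\ge 0$ the processes $\{S^H_{t+s}-S^H_s,\ t\ge0\}$ and $\{S^H_t-S^H_0,\ t\ge0\}$ have the same finite-dimensional distributions. Still, $E[X_t^2]<\infty$ for all $t\ge0$, and there exists a constant $C>0$ depending only on $\theta$ and $H$ such that $$\left|E\left[X_t^2\right]-\frac{H\,\Gamma(2H)}{\theta^{2H}}\right|\le C\,t^{2H-2}\qquad\text{for all } t>2,$$ and $$E\left(X_tX_s\right)\le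 C\,|t-s|^{2H-2}\qquad\text{for all } s,t\ge0 \text{ with } |t-s|>2.$$ -/

import Mathlib

open MeasureTheory ProbabilityTheory
open scoped NNReal

/-- `S = (S_t)_{t ≥ 0}` is a sub-fractional Brownian motion with parameter `H` on the probability
space `(Ω, P)`: a centered Gaussian process with covariance
`E (S_t S_s) = t^{2H} + s^{2H} - ((t + s)^{2H} + |t - s|^{2H}) / 2`. -/
structure IsSubfBm {Ω : Type*} [MeasurableSpace Ω] (P : Measure Ω) (H : ℝ)
    (S : ℝ≥0 → Ω → ℝ) : Prop where
  gaussian : IsGaussianProcess S P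
  centered : ∀ t, ∫ ω, S t ω ∂P = 0
  covariance : ∀ t s : ℝ≥0, ∫ ω, S t ω * S s ω ∂P =
    (t : ℝ) ^ (2 * H) + (s : ℝ) ^ (2 * H)
      - (1 / 2) * (((t : ℝ) + s) ^ (2 * H) + |(t : ℝ) - s| ^ (2 * H))

/-- `X` is a continuous solution of the Langevin equation `X_0 = 0`, `dX_t = -θ X_t dt + dG_t`:
almost surely the path `t ↦ X_t` is continuous and starts at `0`, and
`X_t = -θ ∫_0^t X_r dr + G_t` for all `t ≥ 0`. -/
structure IsLangevinSolution {Ω : Type*} [MeasurableSpace Ω] (P : Measure Ω) (θ : ℝ)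
    (G X : ℝ≥0 → Ω → ℝ) : Prop where
  continuous : ∀ᵐ ω ∂P, Continuous fun t => X t ω
  init : ∀ᵐ ω ∂P, X 0 ω = 0
  equation : ∀ᵐ ω ∂P, ∀ t : ℝ≥0,
    X t ω = -θ * (∫ r in (0 : ℝ)..t, X r.toNNReal ω) + G t ω

/-- `G` has stationary increments: for every `s ≥ 0`, the processes `(G_{t+s} - G_s)_{t ≥ 0}` and
`(G_t - G_0)_{t ≥ 0}` have the same finite-dimensional distributions. -/
def HasStationaryIncrements {Ω : Type*} [MeasurableSpace Ω] (P : Measure Ω)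
    (G : ℝ≥0 → Ω → ℝ) : Prop :=
  ∀ (s : ℝ≥0) (I : Finset ℝ≥0),
    IdentDistrib (fun ω (t : I) => G (t + s) ω - G s ω) (fun ω (t : I) => G t ω - G 0 ω) P P

/-!
Solving the Langevin equation pathwise gives `X_t = ∫_0^t e^{-θ (t - r)} dS_r`, an integral which
makes sense by parts and kills constants. Hence the covariance of `X` is a double integral of the
covariance of `S` that sees only its rectangular increments: terms depending on one variable alone
drop out, and with `a = 2 * H` the kernel may be replaced by `-(|x - y| ^ a + |x + y| ^ a) / 2`.

For the variance, the double integral of `|x - y| ^ a` has a closed form that differs from its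
limit, given by `Γ (a + 1)`, by `O(t ^ (a - 2))`, and the part `|x + y| ^ a` contributes
`O(t ^ (a - 2))`, because its rectangular increments at distance `t` from the origin are of the
order of its second derivative. For the covariance at times `s < t`, split the noise up to time `t`
at the midpoint of `s` and `t`: the recent noise has rectangular increments of order
`(t - s) ^ (a - 2)` against the noise before `s`, while the earlier noise is damped by
`e^{-θ (t - s) / 2}`, which is smaller still.
-/

/-- The integral `∫_p^t e^{-θ (t - r)} dh(r)`, defined for every continuous `h` through integration
by parts. It is the contribution of the noise `h` on `[p, t]` to the solution at time `t` of the
Langevin equation driven by `h`. -/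
noncomputable def ouIntegral (θ p t : ℝ) (h : ℝ → ℝ) : ℝ :=
  h t - Real.exp (-θ * (t - p)) * h p - θ * ∫ r in p..t, Real.exp (-θ * (t - r)) * h r

section ouIntegral

lemma ouIntegral_eq_integral_deriv (θ p t : ℝ) {h h' : ℝ → ℝ} (hd : ∀ r, HasDerivAt h (h' r) r)
    (hc : Continuous h') :
    ouIntegral θ p t h = ∫ r in p..t, Real.exp (-θ * (t - r)) * h' r := by
  have hh : Continuous h := continuous_iff_continuousAt.2 fun r => (hd r).continuousAt
  have hprod : ∀ r ∈ Set.uIcc p t, HasDerivAt (fun r => Real.exp (-θ * (t - r)) * h r)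
      (θ * (Real.exp (-θ * (t - r)) * h r) + Real.exp (-θ * (t - r)) * h' r) r := fun r _ => by
    refine (((((hasDerivAt_id r).const_sub t).const_mul (-θ)).exp).mul (hd r)).congr_deriv ?_
    simp only [id]
    ring
  have hftc := intervalIntegral.integral_eq_sub_of_hasDerivAt hprod
    (Continuous.intervalIntegrable (by fun_prop) _ _)
  rw [intervalIntegral.integral_add (Continuous.intervalIntegrable (by fun_prop) _ _)
    (Continuous.intervalIntegrable (by fun_prop) _ _), intervalIntegral.integral_const_mul,
    sub_self, mul_zero, Real.exp_zero, one_mul] at hftc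
  rw [ouIntegral]
  linarith

lemma ouIntegral_const (θ p t c : ℝ) : ouIntegral θ p t (fun _ => c) = 0 := by
  simp [ouIntegral_eq_integral_deriv θ p t (fun r => hasDerivAt_const r c) continuous_const]

lemma ouIntegral_id (θ p t : ℝ) :
    ouIntegral θ p t (fun r => r) = ∫ r in p..t, Real.exp (-θ * (t - r)) := by
  simp [ouIntegral_eq_integral_deriv θ p t hasDerivAt_id' continuous_const]

lemma mul_integral_exp (θ p t : ℝ) :
    θ * ∫ r in p..t, Real.exp (-θ * (t - r)) = 1 - Real.exp (-θ * (t - p)) := by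
  have h := ouIntegral_const θ p t 1
  simp only [ouIntegral, mul_one] at h
  linarith

lemma ouIntegral_add (θ p t : ℝ) {g h : ℝ → ℝ} (hg : Continuous g) (hh : Continuous h) :
    ouIntegral θ p t (fun x => g x + h x) = ouIntegral θ p t g + ouIntegral θ p t h := by
  simp only [ouIntegral, mul_add]
  rw [intervalIntegral.integral_add (Continuous.intervalIntegrable (by fun_prop) _ _)
    (Continuous.intervalIntegrable (by fun_prop) _ _)]
  ring

lemma ouIntegral_const_mul (θ p t c : ℝ) (h : ℝ → ℝ) :
    ouIntegral θ p t (fun x => c * h x) = c * ouIntegral θ p t h := by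
  simp only [ouIntegral, mul_left_comm _ c, intervalIntegral.integral_const_mul]
  ring

lemma ouIntegral_sub (θ p t : ℝ) {g h : ℝ → ℝ} (hg : Continuous g) (hh : Continuous h) :
    ouIntegral θ p t (fun x => g x - h x) = ouIntegral θ p t g - ouIntegral θ p t h := by
  have h := ouIntegral_add θ p t hg (hh.const_mul (-1))
  rw [ouIntegral_const_mul] at h
  simpa [sub_eq_add_neg] using h

lemma ouIntegral_congr (θ : ℝ) {p t : ℝ} (hpt : p ≤ t) {g h : ℝ → ℝ}
    (hgh : ∀ r ∈ Set.Icc p t, g r = h r) : ouIntegral θ p t g = ouIntegral θ p t h := by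
  have hintegral : ∫ r in p..t, Real.exp (-θ * (t - r)) * g r
      = ∫ r in p..t, Real.exp (-θ * (t - r)) * h r := by
    refine intervalIntegral.integral_congr fun r hr => ?_
    simp only [hgh r (Set.uIcc_of_le hpt ▸ hr)]
  rw [ouIntegral, ouIntegral, hintegral, hgh t ⟨hpt, le_rfl⟩, hgh p ⟨le_rfl, hpt⟩]

lemma ouIntegral_eq_add_exp_mul (θ q p t : ℝ) {h : ℝ → ℝ} (hh : Continuous h) :
    ouIntegral θ q t h
      = ouIntegral θ p t h + Real.exp (-θ * (t - p)) * ouIntegral θ q p h := by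
  have hexp : ∀ r, Real.exp (-θ * (t - r))
      = Real.exp (-θ * (t - p)) * Real.exp (-θ * (p - r)) := fun r => by
    rw [← Real.exp_add]
    ring_nf
  have hpast : ∫ r in q..p, Real.exp (-θ * (t - r)) * h r
      = Real.exp (-θ * (t - p)) * ∫ r in q..p, Real.exp (-θ * (p - r)) * h r := by
    rw [← intervalIntegral.integral_const_mul]
    exact intervalIntegral.integral_congr fun r _ => by simp only [hexp r, mul_assoc]
  have hsplit := intervalIntegral.integral_add_adjacent_intervals (μ := volume)
    (f := fun r => Real.exp (-θ * (t - r)) * h r) (a := q) (b := p) (c := t)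
    (Continuous.intervalIntegrable (by fun_prop) _ _)
    (Continuous.intervalIntegrable (by fun_prop) _ _)
  simp only [ouIntegral]
  rw [← hsplit, hpast, hexp q]
  ring

lemma ouIntegral_eq_increments (θ p t : ℝ) {h : ℝ → ℝ} (hh : Continuous h) :
    ouIntegral θ p t h = Real.exp (-θ * (t - p)) * (h t - h p)
      + θ * ∫ r in p..t, Real.exp (-θ * (t - r)) * (h t - h r) := by
  have hintegral : ∫ r in p..t, Real.exp (-θ * (t - r)) * (h t - h r)
      = (∫ r in p..t, Real.exp (-θ * (t - r))) * h t
        - ∫ r in p..t, Real.exp (-θ * (t - r)) * h r := by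
    rw [← intervalIntegral.integral_mul_const, ← intervalIntegral.integral_sub
      (Continuous.intervalIntegrable (by fun_prop) _ _)
      (Continuous.intervalIntegrable (by fun_prop) _ _)]
    simp only [mul_sub (Real.exp _)]
  rw [hintegral, mul_sub θ, ← mul_assoc, mul_integral_exp, ouIntegral]
  ring

lemma abs_integral_exp_mul_le {θ p t : ℝ} (hpt : p ≤ t) {g b : ℝ → ℝ} (hb : Continuous b)
    (hg : ∀ r ∈ Set.Icc p t, |g r| ≤ b r) :
    |∫ r in p..t, Real.exp (-θ * (t - r)) * g r|
      ≤ ∫ r in p..t, Real.exp (-θ * (t - r)) * b r := by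
  rw [← Real.norm_eq_abs]
  refine intervalIntegral.norm_integral_le_of_norm_le hpt (.of_forall fun r hr => ?_)
    (Continuous.intervalIntegrable (by fun_prop) _ _)
  rw [Real.norm_eq_abs, abs_mul, Real.abs_exp]
  gcongr
  exact hg r (Set.Ioc_subset_Icc_self hr)

/-- Comparison with the path `r ↦ c * r`, whose integral is `c ∫_p^t e^{-θ (t - r)} dr ≤ c / θ`. -/
lemma abs_ouIntegral_le_div {θ p t c : ℝ} (hθ : 0 < θ) (hpt : p ≤ t) {h : ℝ → ℝ}
    (hh : Continuous h) (hc0 : 0 ≤ c) (hc : ∀ r ∈ Set.Icc p t, |h t - h r| ≤ c * (t - r)) :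
    |ouIntegral θ p t h| ≤ c / θ := by
  have hexp : ∫ r in p..t, Real.exp (-θ * (t - r)) ≤ 1 / θ := by
    rw [le_div_iff₀' hθ, mul_integral_exp]
    linarith [Real.exp_pos (-θ * (t - p))]
  calc |ouIntegral θ p t h|
      ≤ Real.exp (-θ * (t - p)) * |h t - h p|
        + θ * |∫ r in p..t, Real.exp (-θ * (t - r)) * (h t - h r)| := by
        rw [ouIntegral_eq_increments θ p t hh]
        refine (abs_add_le _ _).trans_eq ?_
        rw [abs_mul, abs_mul, Real.abs_exp, abs_of_pos hθ]
    _ ≤ Real.exp (-θ * (t - p)) * (c * (t - p))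
        + θ * ∫ r in p..t, Real.exp (-θ * (t - r)) * (c * (t - r)) := by
        gcongr
        · exact hc p ⟨le_rfl, hpt⟩
        · exact abs_integral_exp_mul_le hpt (by fun_prop) hc
    _ = c * ∫ r in p..t, Real.exp (-θ * (t - r)) := by
        rw [← ouIntegral_id, ← ouIntegral_const_mul, ouIntegral_eq_increments _ _ _ (by fun_prop)]
        simp only [mul_sub c]
    _ ≤ c * (1 / θ) := by gcongr
    _ = c / θ := mul_one_div c θ

lemma abs_ouIntegral_le_two_mul {θ p t M : ℝ} (hθ : 0 ≤ θ) (hpt : p ≤ t) {h : ℝ → ℝ}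
    (hM : ∀ r ∈ Set.Icc p t, |h r| ≤ M) : |ouIntegral θ p t h| ≤ 2 * M := by
  calc |ouIntegral θ p t h|
      ≤ |h t| + Real.exp (-θ * (t - p)) * |h p|
        + θ * |∫ r in p..t, Real.exp (-θ * (t - r)) * h r| := by
        refine (abs_sub _ _).trans (add_le_add (abs_sub _ _) le_rfl |>.trans_eq ?_)
        rw [abs_mul, abs_mul, Real.abs_exp, abs_of_nonneg hθ]
    _ ≤ M + Real.exp (-θ * (t - p)) * M + θ * ∫ r in p..t, Real.exp (-θ * (t - r)) * M := by
        gcongr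
        · exact hM t ⟨hpt, le_rfl⟩
        · exact hM p ⟨le_rfl, hpt⟩
        · exact abs_integral_exp_mul_le hpt continuous_const hM
    _ = 2 * M := by
        rw [intervalIntegral.integral_mul_const, ← mul_assoc, mul_integral_exp]
        ring

lemma continuous_ouIntegral (θ p t : ℝ) {Q : ℝ → ℝ → ℝ} (hQ : Continuous (Function.uncurry Q)) :
    Continuous fun x => ouIntegral θ p t (Q x) := by
  have hp : Continuous fun x => Q x p := hQ.comp (by fun_prop : Continuous fun x => (x, p))
  have ht : Continuous fun x => Q x t := hQ.comp (by fun_prop : Continuous fun x => (x, t))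
  have hintegral : Continuous fun x => ∫ r in p..t, Real.exp (-θ * (t - r)) * Q x r := by
    refine intervalIntegral.continuous_parametric_intervalIntegral_of_continuous' ?_ p t
    exact (by fun_prop : Continuous fun z : ℝ × ℝ => Real.exp (-θ * (t - z.2))).mul hQ
  exact (ht.sub (hp.const_mul _)).sub (hintegral.const_mul θ)

end ouIntegral

/-- The covariance at times `t`, `s` of the Ornstein–Uhlenbeck process started at `0` whose driving
process has covariance `Q`. -/
noncomputable def ouCov (θ : ℝ) (Q : ℝ → ℝ → ℝ) (t s : ℝ) : ℝ :=
  ouIntegral θ 0 t fun x => ouIntegral θ 0 s (Q x)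

section ouCov

variable {Q R : ℝ → ℝ → ℝ}

lemma continuous_kernel_section (hQ : Continuous (Function.uncurry Q)) (x : ℝ) :
    Continuous (Q x) :=
  hQ.comp (by fun_prop : Continuous fun y => (x, y))

lemma ouCov_congr (θ : ℝ) {t s : ℝ} (ht : 0 ≤ t) (hs : 0 ≤ s)
    (hQR : ∀ x, 0 ≤ x → ∀ y, 0 ≤ y → Q x y = R x y) : ouCov θ Q t s = ouCov θ R t s :=
  ouIntegral_congr θ ht fun x hx => ouIntegral_congr θ hs fun y hy => hQR x hx.1 y hy.1

lemma ouCov_add (θ t s : ℝ) (hQ : Continuous (Function.uncurry Q))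
    (hR : Continuous (Function.uncurry R)) :
    ouCov θ (fun x y => Q x y + R x y) t s = ouCov θ Q t s + ouCov θ R t s := by
  simp only [ouCov]
  rw [← ouIntegral_add θ 0 t (continuous_ouIntegral θ 0 s hQ) (continuous_ouIntegral θ 0 s hR)]
  simp only [ouIntegral_add θ 0 s (continuous_kernel_section hQ _) (continuous_kernel_section hR _)]

lemma ouCov_marginals_add (θ c t s : ℝ) (g : ℝ → ℝ) {h : ℝ → ℝ} (hh : Continuous h)
    (hQ : Continuous (Function.uncurry Q)) :
    ouCov θ (fun x y => g x + h y + c * Q x y) t s = c * ouCov θ Q t s := by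
  have hinner : ∀ x, ouIntegral θ 0 s (fun y => g x + h y + c * Q x y)
      = ouIntegral θ 0 s h + c * ouIntegral θ 0 s (Q x) := fun x => by
    have hQx := continuous_kernel_section hQ x
    rw [ouIntegral_add (g := fun y => g x + h y) θ 0 s (continuous_const.add hh)
      (hQx.const_mul c), ouIntegral_add θ 0 s continuous_const hh, ouIntegral_const, zero_add,
      ouIntegral_const_mul]
  simp only [ouCov, hinner]
  rw [ouIntegral_add θ 0 t continuous_const ((continuous_ouIntegral θ 0 s hQ).const_mul c),
    ouIntegral_const, zero_add, ouIntegral_const_mul]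

lemma abs_ouCov_le_four_mul {θ t s M : ℝ} (hθ : 0 ≤ θ) (ht : 0 ≤ t) (hs : 0 ≤ s)
    (hM : ∀ x ∈ Set.Icc 0 t, ∀ y ∈ Set.Icc 0 s, |Q x y| ≤ M) : |ouCov θ Q t s| ≤ 4 * M := by
  have h : |ouCov θ Q t s| ≤ 2 * (2 * M) := abs_ouIntegral_le_two_mul hθ ht fun x hx =>
    abs_ouIntegral_le_two_mul hθ hs (hM x hx)
  linarith

/-- The noise after time `p` contributes at most `c / θ ^ 2`, and the contribution of the earlier
noise has been damped by the factor `e^{-θ (t - p)}`. -/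
lemma abs_ouCov_le_add_exp_mul {θ p t s c : ℝ} (hθ : 0 < θ) (hpt : p ≤ t) (hs : 0 ≤ s)
    (hc : 0 ≤ c) (hQ : Continuous (Function.uncurry Q))
    (hrect : ∀ x ∈ Set.Icc p t, ∀ u ∈ Set.Icc 0 s,
      |(Q t s - Q x s) - (Q t u - Q x u)| ≤ c * (t - x) * (s - u)) :
    |ouCov θ Q t s| ≤ c / θ ^ 2 + Real.exp (-θ * (t - p)) * |ouCov θ Q p s| := by
  have hφ := continuous_ouIntegral θ 0 s hQ
  have hrecent : |ouIntegral θ p t fun x => ouIntegral θ 0 s (Q x)| ≤ c / θ ^ 2 := by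
    rw [pow_two, ← div_div]
    refine abs_ouIntegral_le_div hθ hpt hφ (by positivity) fun x hx => ?_
    have htx : 0 ≤ t - x := sub_nonneg.2 hx.2
    have hQt := continuous_kernel_section hQ t
    have hQx := continuous_kernel_section hQ x
    rw [← ouIntegral_sub θ 0 s hQt hQx, div_mul_eq_mul_div]
    exact abs_ouIntegral_le_div hθ hs (hQt.sub hQx) (by positivity) (hrect x hx)
  rw [ouCov, ouIntegral_eq_add_exp_mul θ 0 p t hφ]
  refine (abs_add_le _ _).trans (add_le_add hrecent ?_)
  rw [abs_mul, Real.abs_exp, ouCov]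

end ouCov

section Variogram

variable {f : ℝ → ℝ}

lemma two_mul_integral_exp_mul_primitive (θ t : ℝ) (hf : Continuous f) :
    2 * θ * ∫ x in (0 : ℝ)..t, Real.exp (-(2 * θ) * (t - x)) *
        ∫ z in (0 : ℝ)..x, Real.exp (-θ * z) * f z
      = (∫ z in (0 : ℝ)..t, Real.exp (-θ * z) * f z)
        - Real.exp (-θ * t) * ∫ r in (0 : ℝ)..t, Real.exp (-θ * (t - r)) * f r := by
  have hg : Continuous fun z => Real.exp (-θ * z) * f z := by fun_prop
  have hparts := ouIntegral_eq_integral_deriv (2 * θ) 0 t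
    (fun x => (hg.integral_hasStrictDerivAt 0 x).hasDerivAt) hg
  have hfactor : ∫ x in (0 : ℝ)..t, Real.exp (-(2 * θ) * (t - x)) * (Real.exp (-θ * x) * f x)
      = Real.exp (-θ * t) * ∫ r in (0 : ℝ)..t, Real.exp (-θ * (t - r)) * f r := by
    rw [← intervalIntegral.integral_const_mul]
    refine intervalIntegral.integral_congr fun x _ => ?_
    simp only [← mul_assoc, ← Real.exp_add]
    ring_nf
  rw [hfactor, ouIntegral, intervalIntegral.integral_same] at hparts
  linarith

lemma two_mul_integral_exp_mul_integral_exp (θ t : ℝ) (hf : Continuous f) :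
    2 * θ * ∫ v in (0 : ℝ)..t, Real.exp (-θ * v) *
        ∫ r in (0 : ℝ)..v, Real.exp (-θ * (v - r)) * f r
      = (∫ z in (0 : ℝ)..t, Real.exp (-θ * z) * f z)
        - Real.exp (-θ * t) * ∫ r in (0 : ℝ)..t, Real.exp (-θ * (t - r)) * f r := by
  have hleft : ∫ v in (0 : ℝ)..t, Real.exp (-θ * v) *
        ∫ r in (0 : ℝ)..v, Real.exp (-θ * (v - r)) * f r
      = Real.exp (-(2 * θ) * t) * ∫ v in (0 : ℝ)..t, Real.exp (-(2 * -θ) * (t - v)) *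
        ∫ r in (0 : ℝ)..v, Real.exp (-(-θ) * r) * f r := by
    simp only [← intervalIntegral.integral_const_mul]
    refine intervalIntegral.integral_congr fun v _ => intervalIntegral.integral_congr fun r _ => ?_
    simp only [← mul_assoc, ← Real.exp_add]
    ring_nf
  have hfirst : ∫ z in (0 : ℝ)..t, Real.exp (-θ * z) * f z
      = Real.exp (-(2 * θ) * t) * (Real.exp (-(-θ) * t) *
        ∫ r in (0 : ℝ)..t, Real.exp (-(-θ) * (t - r)) * f r) := by
    simp only [← intervalIntegral.integral_const_mul]
    refine intervalIntegral.integral_congr fun r _ => ?_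
    simp only [← mul_assoc, ← Real.exp_add]
    ring_nf
  have hsecond : Real.exp (-θ * t) * ∫ r in (0 : ℝ)..t, Real.exp (-θ * (t - r)) * f r
      = Real.exp (-(2 * θ) * t) * ∫ r in (0 : ℝ)..t, Real.exp (-(-θ) * r) * f r := by
    simp only [← intervalIntegral.integral_const_mul]
    refine intervalIntegral.integral_congr fun r _ => ?_
    simp only [← mul_assoc, ← Real.exp_add]
    ring_nf
  rw [hleft, hfirst, hsecond]
  linear_combination -Real.exp (-(2 * θ) * t) * two_mul_integral_exp_mul_primitive (-θ) t hf

lemma integral_exp_mul_comp_sub (θ t : ℝ) (f : ℝ → ℝ) :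
    ∫ r in (0 : ℝ)..t, Real.exp (-θ * (t - r)) * f (t - r)
      = ∫ z in (0 : ℝ)..t, Real.exp (-θ * z) * f z := by
  simpa using intervalIntegral.integral_comp_sub_left (fun z => Real.exp (-θ * z) * f z) t
    (a := 0) (b := t)

lemma integral_exp_mul_comp_sub_of_even (θ t x : ℝ) (hf : Continuous f)
    (heven : ∀ z, f (-z) = f z) :
    ∫ r in (0 : ℝ)..t, Real.exp (-θ * (t - r)) * f (x - r)
      = Real.exp (-θ * (t - x)) * (∫ z in (0 : ℝ)..x, Real.exp (-θ * z) * f z)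
        + ∫ r in (0 : ℝ)..(t - x), Real.exp (-θ * (t - x - r)) * f r := by
  have hbelow : ∫ r in (0 : ℝ)..x, Real.exp (-θ * (t - r)) * f (x - r)
      = Real.exp (-θ * (t - x)) * ∫ z in (0 : ℝ)..x, Real.exp (-θ * z) * f z := by
    rw [← integral_exp_mul_comp_sub, ← intervalIntegral.integral_const_mul]
    refine intervalIntegral.integral_congr fun r _ => ?_
    simp only [← mul_assoc, ← Real.exp_add]
    ring_nf
  have habove : ∫ r in x..t, Real.exp (-θ * (t - r)) * f (x - r)
      = ∫ r in (0 : ℝ)..(t - x), Real.exp (-θ * (t - x - r)) * f r := by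
    rw [← sub_self x, ← intervalIntegral.integral_comp_sub_right]
    refine intervalIntegral.integral_congr fun r _ => ?_
    simp only [← heven (x - r), neg_sub, sub_sub_sub_cancel_right]
  rw [← intervalIntegral.integral_add_adjacent_intervals (b := x)
    (Continuous.intervalIntegrable (by fun_prop) _ _)
    (Continuous.intervalIntegrable (by fun_prop) _ _), hbelow, habove]

lemma mul_integral_integral_exp_mul_comp_sub (θ t : ℝ) (hf : Continuous f)
    (heven : ∀ z, f (-z) = f z) :
    θ * ∫ x in (0 : ℝ)..t, Real.exp (-θ * (t - x)) *
        ∫ r in (0 : ℝ)..t, Real.exp (-θ * (t - r)) * f (x - r)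
      = (∫ z in (0 : ℝ)..t, Real.exp (-θ * z) * f z)
        - Real.exp (-θ * t) * ∫ r in (0 : ℝ)..t, Real.exp (-θ * (t - r)) * f r := by
  set L : ℝ → ℝ := fun x => ∫ z in (0 : ℝ)..x, Real.exp (-θ * z) * f z
  set N : ℝ → ℝ := fun v => ∫ r in (0 : ℝ)..v, Real.exp (-θ * (v - r)) * f r
  have hLc : Continuous L := intervalIntegral.continuous_parametric_intervalIntegral_of_continuous
    (by fun_prop) continuous_id
  have hNc : Continuous N := intervalIntegral.continuous_parametric_intervalIntegral_of_continuous
    (by fun_prop) continuous_id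
  have hsplit : ∀ x, Real.exp (-θ * (t - x)) *
        (∫ r in (0 : ℝ)..t, Real.exp (-θ * (t - r)) * f (x - r))
      = Real.exp (-(2 * θ) * (t - x)) * L x + Real.exp (-θ * (t - x)) * N (t - x) := fun x => by
    rw [integral_exp_mul_comp_sub_of_even θ t x hf heven, mul_add, ← mul_assoc, ← Real.exp_add]
    congr 3
    ring
  simp only [hsplit]
  rw [intervalIntegral.integral_add (Continuous.intervalIntegrable (by fun_prop) _ _)
    (Continuous.intervalIntegrable (by fun_prop) _ _), integral_exp_mul_comp_sub θ t N]
  linear_combination (two_mul_integral_exp_mul_primitive θ t hf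
    + two_mul_integral_exp_mul_integral_exp θ t hf) / 2

lemma ouCov_comp_sub_of_even (θ t : ℝ) (hf : Continuous f) (heven : ∀ z, f (-z) = f z) :
    ouCov θ (fun x y => f (x - y)) t t
      = (1 + Real.exp (-θ * t) ^ 2) * f 0 - 2 * Real.exp (-θ * t) * f t
        - θ * ((∫ z in (0 : ℝ)..t, Real.exp (-θ * z) * f z)
          - Real.exp (-θ * t) * ∫ r in (0 : ℝ)..t, Real.exp (-θ * (t - r)) * f r) := by
  set E := Real.exp (-θ * t) with hE
  set I : ℝ → ℝ := fun x => ∫ r in (0 : ℝ)..t, Real.exp (-θ * (t - r)) * f (x - r)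
  have hI : Continuous I :=
    intervalIntegral.continuous_parametric_intervalIntegral_of_continuous' (by fun_prop) _ _
  have hIt : I t = ∫ z in (0 : ℝ)..t, Real.exp (-θ * z) * f z := integral_exp_mul_comp_sub θ t f
  have hI0 : I 0 = ∫ r in (0 : ℝ)..t, Real.exp (-θ * (t - r)) * f r := by
    simp only [I, zero_sub, heven]
  have hinner : ∀ x, ouIntegral θ 0 t (fun y => f (x - y)) = f (t - x) - E * f x - θ * I x :=
    fun x => by rw [ouIntegral, sub_zero, sub_zero, ← heven (x - t), neg_sub]
  have houter : ∫ x in (0 : ℝ)..t, Real.exp (-θ * (t - x)) * (f (t - x) - E * f x - θ * I x)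
      = I t - E * I 0 - θ * ∫ x in (0 : ℝ)..t, Real.exp (-θ * (t - x)) * I x := by
    simp only [mul_sub (Real.exp _), mul_left_comm (Real.exp _)]
    rw [intervalIntegral.integral_sub (Continuous.intervalIntegrable (by fun_prop) _ _)
      (Continuous.intervalIntegrable (by fun_prop) _ _), intervalIntegral.integral_sub
      (Continuous.intervalIntegrable (by fun_prop) _ _)
      (Continuous.intervalIntegrable (by fun_prop) _ _), intervalIntegral.integral_const_mul,
      intervalIntegral.integral_const_mul, integral_exp_mul_comp_sub, hIt, hI0]
  have hdouble : θ * ∫ x in (0 : ℝ)..t, Real.exp (-θ * (t - x)) * I x = I t - E * I 0 := by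
    rw [hIt, hI0]
    exact mul_integral_integral_exp_mul_comp_sub θ t hf heven
  rw [ouCov, ouIntegral]
  simp only [hinner]
  rw [houter, hdouble, ← hIt, ← hI0, sub_self t, sub_zero, ← hE]
  ring

end Variogram

section Rpow

variable {a θ t : ℝ}

lemma exp_neg_mul_mul_rpow_le (hθ : 0 < θ) (ht : 0 < t) :
    Real.exp (-θ * t) * t ^ a ≤ 2 / θ ^ 2 * t ^ (a - 2) := by
  have hpow : t ^ a = t ^ 2 * t ^ (a - 2) := by
    rw [← Real.rpow_natCast, ← Real.rpow_add ht]
    norm_num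
  have hexp : Real.exp (-θ * t) * t ^ 2 ≤ 2 / θ ^ 2 := by
    rw [neg_mul, Real.exp_neg, inv_mul_le_iff₀ (Real.exp_pos _), mul_div_assoc',
      le_div_iff₀ (by positivity)]
    have := Real.quadratic_le_exp_of_nonneg (mul_pos hθ ht).le
    nlinarith [mul_pos hθ ht]
  rw [hpow, ← mul_assoc]
  gcongr

lemma exp_neg_mul_le_rpow (ha0 : 0 ≤ a) (ha : a ≤ 2) (hθ : 0 < θ) (ht : 0 < t) :
    Real.exp (-θ * t) ≤ (1 + 2 / θ ^ 2) * t ^ (a - 2) := by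
  have hdecay := exp_neg_mul_mul_rpow_le (a := a) hθ ht
  have hpos : 0 ≤ t ^ (a - 2) := by positivity
  rcases le_total t 1 with h1 | h1
  · have hexp : Real.exp (-θ * t) ≤ 1 := Real.exp_le_one_iff.2 (by nlinarith)
    have hone : 1 ≤ t ^ (a - 2) := Real.one_le_rpow_of_pos_of_le_one_of_nonpos ht h1 (by linarith)
    have : 0 ≤ 2 / θ ^ 2 * t ^ (a - 2) := by positivity
    linarith
  · have hexp : Real.exp (-θ * t) ≤ Real.exp (-θ * t) * t ^ a :=
      le_mul_of_one_le_right (Real.exp_pos _).le (Real.one_le_rpow h1 ha0)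
    linarith

lemma half_rpow_sub_two_le (ha : 0 ≤ a) (ht : 0 ≤ t) : (t / 2) ^ (a - 2) ≤ 4 * t ^ (a - 2) := by
  have h2 : (1 / 4 : ℝ) ≤ 2 ^ (a - 2) := by
    calc (1 / 4 : ℝ) = 2 ^ (-2 : ℝ) := by norm_num [Real.rpow_neg]
      _ ≤ 2 ^ (a - 2) := Real.rpow_le_rpow_of_exponent_le one_le_two (by linarith)
  rw [Real.div_rpow ht two_pos.le, div_le_iff₀ (by positivity)]
  nlinarith [Real.rpow_nonneg ht (a - 2)]

lemma two_mul_rpow_le (ha : a ≤ 2) (ht : 0 ≤ t) : (2 * t) ^ a ≤ 4 * t ^ a := by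
  have h2 : (2 : ℝ) ^ a ≤ 4 :=
    (Real.rpow_le_rpow_of_exponent_le one_le_two ha).trans_eq (by norm_num)
  rw [Real.mul_rpow two_pos.le ht]
  gcongr

lemma continuous_abs_rpow (ha : 0 ≤ a) : Continuous fun x : ℝ => |x| ^ a :=
  continuous_abs.rpow_const fun _ => Or.inr ha

lemma integrableOn_exp_mul_rpow (ha : -1 < a) (hθ : 0 < θ) :
    IntegrableOn (fun z => Real.exp (-θ * z) * z ^ a) (Set.Ioi 0) := by
  simpa [mul_comm] using integrableOn_rpow_mul_exp_neg_mul_rpow ha one_pos hθ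

lemma integral_exp_mul_rpow (ha : -1 < a) (hθ : 0 < θ) :
    ∫ z in Set.Ioi 0, Real.exp (-θ * z) * z ^ a = Real.Gamma (a + 1) / θ ^ (a + 1) := by
  have h := Real.integral_rpow_mul_exp_neg_mul_Ioi (a := a + 1) (by linarith) hθ
  rw [add_sub_cancel_right, one_div, Real.inv_rpow hθ.le] at h
  simpa [mul_comm, div_eq_mul_inv] using h

lemma integral_Ioi_exp_mul_rpow_le (ha0 : -1 < a) (ha : a ≤ 2) (hθ : 0 < θ) (ht : 0 < t) :
    ∫ z in Set.Ioi t, Real.exp (-θ * z) * z ^ a ≤ 2 / θ ^ 3 * t ^ (a - 2) := by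
  have hint := integrableOn_exp_mul_rpow (a := 2) (by norm_num) hθ
  have hsub : Set.Ioi t ⊆ Set.Ioi 0 := Set.Ioi_subset_Ioi ht.le
  calc ∫ z in Set.Ioi t, Real.exp (-θ * z) * z ^ a
      ≤ ∫ z in Set.Ioi t, t ^ (a - 2) * (Real.exp (-θ * z) * z ^ (2 : ℝ)) := by
        refine setIntegral_mono_on ((integrableOn_exp_mul_rpow ha0 hθ).mono_set hsub)
          ((hint.mono_set hsub).const_mul _) measurableSet_Ioi fun z hz => ?_
        have hz0 : 0 < z := ht.trans hz
        have hpow : z ^ a ≤ t ^ (a - 2) * z ^ (2 : ℝ) := by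
          rw [← div_le_iff₀ (by positivity), ← Real.rpow_sub hz0]
          exact Real.rpow_le_rpow_of_nonpos ht (le_of_lt hz) (by linarith)
        rw [mul_left_comm]
        gcongr
    _ ≤ ∫ z in Set.Ioi 0, t ^ (a - 2) * (Real.exp (-θ * z) * z ^ (2 : ℝ)) :=
        setIntegral_mono_set (hint.const_mul _)
          ((ae_restrict_mem measurableSet_Ioi).mono fun z (hz : 0 < z) => by positivity)
          hsub.eventuallyLE
    _ = 2 / θ ^ 3 * t ^ (a - 2) := by
        have hGamma : Real.Gamma (2 + 1) = 2 := by simpa using Real.Gamma_nat_eq_factorial 2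
        rw [integral_const_mul, integral_exp_mul_rpow (by norm_num) hθ, hGamma, mul_comm]
        norm_num

lemma abs_integral_exp_mul_abs_rpow_sub_le (ha0 : -1 < a) (ha : a ≤ 2) (hθ : 0 < θ) (ht : 0 < t) :
    |(∫ z in (0 : ℝ)..t, Real.exp (-θ * z) * |z| ^ a) - Real.Gamma (a + 1) / θ ^ (a + 1)|
      ≤ 2 / θ ^ 3 * t ^ (a - 2) := by
  have htail : (∫ z in (0 : ℝ)..t, Real.exp (-θ * z) * |z| ^ a)
      - Real.Gamma (a + 1) / θ ^ (a + 1) = -∫ z in Set.Ioi t, Real.exp (-θ * z) * z ^ a := by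
    have habs : ∫ z in (0 : ℝ)..t, Real.exp (-θ * z) * |z| ^ a
        = ∫ z in (0 : ℝ)..t, Real.exp (-θ * z) * z ^ a := by
      refine intervalIntegral.integral_congr fun z hz => ?_
      rw [Set.uIcc_of_le ht.le] at hz
      simp only [abs_of_nonneg hz.1]
    rw [← integral_exp_mul_rpow ha0 hθ, habs,
      ← intervalIntegral.integral_Ioi_sub_Ioi (integrableOn_exp_mul_rpow ha0 hθ) ht.le]
    ring
  rw [htail, abs_neg, abs_of_nonneg (setIntegral_nonneg measurableSet_Ioi fun z hz => ?_)]
  · exact integral_Ioi_exp_mul_rpow_le ha0 ha hθ ht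
  · have hz0 : 0 < z := ht.trans hz
    positivity

lemma abs_rpow_sub_rpow_le {b D x y : ℝ} (hb : b ≤ 1) (hD : 0 < D) (hx : D ≤ x) (hy : D ≤ y) :
    |y ^ b - x ^ b| ≤ |b| * D ^ (b - 1) * |y - x| := by
  have hbound : ∀ z ∈ Set.Ici D, ‖b * z ^ (b - 1)‖ ≤ |b| * D ^ (b - 1) := fun z hz => by
    rw [Real.norm_eq_abs, abs_mul, Real.abs_rpow_of_nonneg (hD.le.trans hz),
      abs_of_pos (hD.trans_le hz)]
    gcongr ?_ * ?_
    exact Real.rpow_le_rpow_of_nonpos hD hz (by linarith)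
  simpa only [Real.norm_eq_abs] using (convex_Ici D).norm_image_sub_le_of_norm_hasDerivWithin_le
    (fun z hz => (Real.hasDerivAt_rpow_const (p := b)
      (Or.inl (hD.trans_le hz).ne')).hasDerivWithinAt) hbound hx hy

lemma abs_rpow_second_difference_le {D x y k : ℝ} (ha0 : 0 ≤ a) (ha : a ≤ 2) (hD : 0 < D)
    (hx : D ≤ x) (hy : D ≤ y) (hk : 0 ≤ k) :
    |(|y + k| ^ a - |y| ^ a) - (|x + k| ^ a - |x| ^ a)| ≤ 2 * D ^ (a - 2) * k * |y - x| := by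
  have hab : a * |a - 1| ≤ 2 := by
    rcases abs_cases (a - 1) with h | h <;> rw [h.1] <;> nlinarith
  have hderiv : ∀ z ∈ Set.Ici D, HasDerivWithinAt (fun z : ℝ => (z + k) ^ a - z ^ a)
      (a * ((z + k) ^ (a - 1) - z ^ (a - 1))) (Set.Ici D) z := fun z (hz : D ≤ z) => by
    have hzk := ((hasDerivAt_id z).add_const k).rpow_const (p := a)
      (Or.inl (by simp only [id]; linarith))
    have hz0 := Real.hasDerivAt_rpow_const (x := z) (p := a) (Or.inl (by linarith))
    refine ((hzk.sub hz0).congr_deriv ?_).hasDerivWithinAt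
    simp [mul_sub]
  have hbound : ∀ z ∈ Set.Ici D,
      ‖a * ((z + k) ^ (a - 1) - z ^ (a - 1))‖ ≤ 2 * D ^ (a - 2) * k := fun z (hz : D ≤ z) => by
    have h := abs_rpow_sub_rpow_le (b := a - 1) (by linarith) hD hz (le_add_of_le_of_nonneg hz hk)
    rw [add_sub_cancel_left, abs_of_nonneg hk, sub_sub, one_add_one_eq_two] at h
    rw [Real.norm_eq_abs, abs_mul, abs_of_nonneg ha0]
    calc a * |(z + k) ^ (a - 1) - z ^ (a - 1)|
        ≤ a * (|a - 1| * D ^ (a - 2) * k) := by gcongr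
      _ = a * |a - 1| * (D ^ (a - 2) * k) := by ring
      _ ≤ 2 * (D ^ (a - 2) * k) := by gcongr
      _ = 2 * D ^ (a - 2) * k := by ring
  rw [abs_of_pos (by linarith : 0 < y + k), abs_of_pos (by linarith : 0 < y),
    abs_of_pos (by linarith : 0 < x + k), abs_of_pos (by linarith : 0 < x)]
  simpa only [Real.norm_eq_abs] using
    (convex_Ici D).norm_image_sub_le_of_norm_hasDerivWithin_le hderiv hbound hx hy

end Rpow

section PowerKernels

variable {a θ t : ℝ}

lemma abs_ouCov_abs_sub_rpow_add_le (ha0 : 0 < a) (ha : a ≤ 2) (hθ : 0 < θ) (ht : 0 < t) :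
    |ouCov θ (fun x y => |x - y| ^ a) t t + a * Real.Gamma a / θ ^ a|
      ≤ 8 / θ ^ 2 * t ^ (a - 2) := by
  set E := Real.exp (-θ * t)
  set L := ∫ z in (0 : ℝ)..t, Real.exp (-θ * z) * |z| ^ a
  set N := ∫ r in (0 : ℝ)..t, Real.exp (-θ * (t - r)) * |r| ^ a
  have hlaplace : θ * |L - Real.Gamma (a + 1) / θ ^ (a + 1)| ≤ 2 / θ ^ 2 * t ^ (a - 2) := by
    calc θ * |L - Real.Gamma (a + 1) / θ ^ (a + 1)|
        ≤ θ * (2 / θ ^ 3 * t ^ (a - 2)) := by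
          gcongr
          exact abs_integral_exp_mul_abs_rpow_sub_le (by linarith) ha hθ ht
      _ = 2 / θ ^ 2 * t ^ (a - 2) := by field_simp
  have hN : θ * |N| ≤ t ^ a := by
    calc θ * |N| ≤ θ * ∫ r in (0 : ℝ)..t, Real.exp (-θ * (t - r)) * t ^ a := by
          gcongr
          refine abs_integral_exp_mul_le ht.le continuous_const fun r hr => ?_
          rw [abs_of_nonneg hr.1, abs_of_nonneg (by have := hr.1; positivity)]
          exact Real.rpow_le_rpow hr.1 hr.2 ha0.le
      _ = (1 - Real.exp (-θ * (t - 0))) * t ^ a := by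
          rw [intervalIntegral.integral_mul_const, ← mul_assoc, mul_integral_exp]
      _ ≤ t ^ a :=
          mul_le_of_le_one_left (by positivity) (sub_le_self _ (Real.exp_pos _).le)
  have hdecay : E * t ^ a ≤ 2 / θ ^ 2 * t ^ (a - 2) := exp_neg_mul_mul_rpow_le hθ ht
  have hgamma : a * Real.Gamma a / θ ^ a = θ * (Real.Gamma (a + 1) / θ ^ (a + 1)) := by
    rw [Real.Gamma_add_one ha0.ne', Real.rpow_add_one hθ.ne']
    field_simp
  have hE : 0 < E := Real.exp_pos _
  calc |ouCov θ (fun x y => |x - y| ^ a) t t + a * Real.Gamma a / θ ^ a|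
      = |-(2 * (E * t ^ a)) - θ * (L - Real.Gamma (a + 1) / θ ^ (a + 1)) + E * (θ * N)| := by
        rw [ouCov_comp_sub_of_even θ t (continuous_abs_rpow ha0.le) fun z => by rw [abs_neg],
          hgamma, abs_zero, Real.zero_rpow ha0.ne', abs_of_pos ht]
        congr 1
        ring
    _ ≤ 2 * (E * t ^ a) + θ * |L - Real.Gamma (a + 1) / θ ^ (a + 1)| + E * (θ * |N|) := by
        refine (abs_add_le _ _).trans (add_le_add ((abs_sub _ _).trans_eq ?_) (le_of_eq ?_))
        · rw [abs_neg, abs_of_nonneg (by positivity), abs_mul, abs_of_pos hθ]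
        · rw [abs_mul, abs_mul, abs_of_pos hE, abs_of_pos hθ]
    _ ≤ 2 * (E * t ^ a) + 2 / θ ^ 2 * t ^ (a - 2) + E * t ^ a := by gcongr
    _ ≤ 8 / θ ^ 2 * t ^ (a - 2) := by linear_combination 3 * hdecay

lemma continuous_abs_add_rpow (ha : 0 ≤ a) :
    Continuous (Function.uncurry fun x y : ℝ => |x + y| ^ a) :=
  (continuous_abs_rpow ha).comp (by fun_prop : Continuous fun z : ℝ × ℝ => z.1 + z.2)

lemma continuous_abs_sub_rpow (ha : 0 ≤ a) :
    Continuous (Function.uncurry fun x y : ℝ => |x - y| ^ a) :=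
  (continuous_abs_rpow ha).comp (by fun_prop : Continuous fun z : ℝ × ℝ => z.1 - z.2)

lemma abs_add_rpow_rect_le {D s u x : ℝ} (ha0 : 0 ≤ a) (ha : a ≤ 2) (hD : 0 < D) (hDx : D ≤ x)
    (hxt : x ≤ t) (hu : 0 ≤ u) (hus : u ≤ s) :
    |(|t + s| ^ a - |x + s| ^ a) - (|t + u| ^ a - |x + u| ^ a)|
      ≤ 2 * D ^ (a - 2) * (t - x) * (s - u) := by
  have h := abs_rpow_second_difference_le (x := x + u) (y := x + s) (k := t - x) ha0 ha hD
    (by linarith) (by linarith) (by linarith)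
  rwa [add_sub_add_left_eq_sub, abs_of_nonneg (sub_nonneg.2 hus), add_right_comm, add_sub_cancel,
    add_right_comm x u, add_sub_cancel] at h

lemma abs_sub_rpow_rect_le {D s u x : ℝ} (ha0 : 0 ≤ a) (ha : a ≤ 2) (hD : 0 < D)
    (hDx : D ≤ x - s) (hxt : x ≤ t) (hus : u ≤ s) :
    |(|t - s| ^ a - |x - s| ^ a) - (|t - u| ^ a - |x - u| ^ a)|
      ≤ 2 * D ^ (a - 2) * (t - x) * (s - u) := by
  have h := abs_rpow_second_difference_le (x := x - u) (y := x - s) (k := t - x) ha0 ha hD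
    (by linarith) hDx (by linarith)
  rwa [sub_sub_sub_cancel_left, abs_sub_comm u, abs_of_nonneg (sub_nonneg.2 hus),
    sub_add_eq_add_sub, add_sub_cancel, sub_add_eq_add_sub, add_sub_cancel] at h

lemma abs_ouCov_abs_add_rpow_le (ha0 : 0 ≤ a) (ha : a ≤ 2) (hθ : 0 < θ) (ht : 0 < t) :
    |ouCov θ (fun x y => |x + y| ^ a) t t| ≤ 136 / θ ^ 2 * t ^ (a - 2) := by
  have hrecent := abs_ouCov_le_add_exp_mul (p := t / 2) (t := t) (s := t)
    (c := 2 * (t / 2) ^ (a - 2)) hθ (by linarith) ht.le (by positivity)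
    (continuous_abs_add_rpow ha0) fun x hx u hu =>
      abs_add_rpow_rect_le ha0 ha (half_pos ht) hx.1 hx.2 hu.1 hu.2
  have hpast : |ouCov θ (fun x y => |x + y| ^ a) (t / 2) t| ≤ 4 * (4 * t ^ a) := by
    refine abs_ouCov_le_four_mul hθ.le (by linarith) ht.le fun x hx y hy => ?_
    have hxy : 0 ≤ x + y := add_nonneg hx.1 hy.1
    rw [abs_of_nonneg hxy, abs_of_nonneg (by positivity)]
    exact (Real.rpow_le_rpow hxy (by linarith [hx.2, hy.2]) ha0).trans (two_mul_rpow_le ha ht.le)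
  have hdecay : Real.exp (-θ * (t - t / 2)) * t ^ a ≤ 8 / θ ^ 2 * t ^ (a - 2) := by
    calc Real.exp (-θ * (t - t / 2)) * t ^ a = Real.exp (-(θ / 2) * t) * t ^ a := by ring_nf
      _ ≤ 2 / (θ / 2) ^ 2 * t ^ (a - 2) := exp_neg_mul_mul_rpow_le (half_pos hθ) ht
      _ = 8 / θ ^ 2 * t ^ (a - 2) := by ring
  calc |ouCov θ (fun x y => |x + y| ^ a) t t|
      ≤ 2 * (t / 2) ^ (a - 2) / θ ^ 2 + Real.exp (-θ * (t - t / 2)) *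
          |ouCov θ (fun x y => |x + y| ^ a) (t / 2) t| := hrecent
    _ ≤ 2 * (4 * t ^ (a - 2)) / θ ^ 2 + Real.exp (-θ * (t - t / 2)) * (4 * (4 * t ^ a)) := by
        gcongr
        exact half_rpow_sub_two_le ha0 ht.le
    _ ≤ 136 / θ ^ 2 * t ^ (a - 2) := by linear_combination 16 * hdecay

end PowerKernels

/-- The covariance of the sub-fractional Brownian motion with parameter `a / 2`, extended to `ℝ × ℝ`
by absolute values so that it is continuous everywhere. -/
noncomputable def subfBmCov (a x y : ℝ) : ℝ :=
  |x| ^ a + |y| ^ a - 1 / 2 * (|x + y| ^ a + |x - y| ^ a)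

section subfBmCov

variable {a θ s t : ℝ}

lemma continuous_subfBmCov (ha : 0 ≤ a) : Continuous (Function.uncurry (subfBmCov a)) :=
  (((continuous_abs_rpow ha).comp continuous_fst).add
    ((continuous_abs_rpow ha).comp continuous_snd)).sub
      (((continuous_abs_add_rpow ha).add (continuous_abs_sub_rpow ha)).const_mul (1 / 2))

lemma ouCov_subfBmCov (ha : 0 ≤ a) (θ t s : ℝ) :
    ouCov θ (subfBmCov a) t s = -(1 / 2) *
      (ouCov θ (fun x y => |x + y| ^ a) t s + ouCov θ (fun x y => |x - y| ^ a) t s) := by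
  have hadd := continuous_abs_add_rpow ha
  have hsub := continuous_abs_sub_rpow ha
  have hsplit : subfBmCov a
      = fun x y => |x| ^ a + |y| ^ a + -(1 / 2) * (|x + y| ^ a + |x - y| ^ a) := by
    funext x y
    rw [subfBmCov, neg_mul, sub_eq_add_neg]
  rw [hsplit, ouCov_marginals_add (Q := fun x y => |x + y| ^ a + |x - y| ^ a) θ _ t s _
    (continuous_abs_rpow ha) (hadd.add hsub), ouCov_add θ t s hadd hsub]

lemma abs_ouCov_subfBmCov_sub_le (ha0 : 0 < a) (ha : a ≤ 2) (hθ : 0 < θ) (ht : 0 < t) :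
    |ouCov θ (subfBmCov a) t t - a / 2 * Real.Gamma a / θ ^ a| ≤ 72 / θ ^ 2 * t ^ (a - 2) := by
  have hadd := abs_le.1 (abs_ouCov_abs_add_rpow_le ha0.le ha hθ ht)
  have hsub := abs_le.1 (abs_ouCov_abs_sub_rpow_add_le ha0 ha hθ ht)
  rw [ouCov_subfBmCov ha0.le, abs_le]
  constructor
  · linear_combination (hadd.2 + hsub.2) / 2
  · linear_combination (hadd.1 + hsub.1) / 2

lemma abs_subfBmCov_le {x y : ℝ} (ha0 : 0 ≤ a) (ha : a ≤ 2) (hx : x ∈ Set.Icc 0 1)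
    (hy : y ∈ Set.Icc 0 1) : |subfBmCov a x y| ≤ 8 := by
  obtain ⟨hx0, hx1⟩ := hx
  obtain ⟨hy0, hy1⟩ := hy
  have hle : ∀ z : ℝ, |z| ≤ 2 → |z| ^ a ≤ 4 := fun z hz =>
    (Real.rpow_le_rpow (abs_nonneg z) hz ha0).trans (by simpa using two_mul_rpow_le ha zero_le_one)
  have hnonneg : ∀ z : ℝ, 0 ≤ |z| ^ a := fun z => by positivity
  rw [subfBmCov, abs_le]
  constructor
  · linarith [hnonneg x, hnonneg y, hle (x + y) (by rw [abs_le]; constructor <;> linarith),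
      hle (x - y) (by rw [abs_le]; constructor <;> linarith)]
  · linarith [hnonneg (x + y), hnonneg (x - y), hle x (by rw [abs_le]; constructor <;> linarith),
      hle y (by rw [abs_le]; constructor <;> linarith)]

lemma exists_abs_ouCov_subfBmCov_le (ha0 : 0 < a) (ha : a ≤ 2) (hθ : 0 < θ) :
    ∃ M, 0 < M ∧ ∀ t, 0 ≤ t → |ouCov θ (subfBmCov a) t t| ≤ M := by
  set v := a / 2 * Real.Gamma a / θ ^ a
  have hv : 0 < v := div_pos (mul_pos (half_pos ha0) (Real.Gamma_pos_of_pos ha0))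
    (Real.rpow_pos_of_pos hθ a)
  refine ⟨32 + (v + 72 / θ ^ 2), by positivity, fun t ht => ?_⟩
  rcases le_total t 1 with h1 | h1
  · have hcrude : |ouCov θ (subfBmCov a) t t| ≤ 4 * 8 :=
      abs_ouCov_le_four_mul hθ.le ht ht fun x hx y hy =>
        abs_subfBmCov_le ha0.le ha ⟨hx.1, hx.2.trans h1⟩ ⟨hy.1, hy.2.trans h1⟩
    have : 0 < v + 72 / θ ^ 2 := by positivity
    linarith
  · have hlimit := abs_ouCov_subfBmCov_sub_le ha0 ha hθ (one_pos.trans_le h1)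
    have hpow : 72 / θ ^ 2 * t ^ (a - 2) ≤ 72 / θ ^ 2 :=
      mul_le_of_le_one_right (by positivity)
        (Real.rpow_le_one_of_one_le_of_nonpos h1 (by linarith))
    have htriangle := abs_sub_abs_le_abs_sub (ouCov θ (subfBmCov a) t t) v
    rw [abs_of_pos hv] at htriangle
    linarith

lemma abs_ouCov_subfBmCov_le_add_exp_mul (ha0 : 0 ≤ a) (ha : a ≤ 2) (hθ : 0 < θ) (hs : 0 ≤ s)
    (hst : s < t) :
    |ouCov θ (subfBmCov a) t s|
      ≤ 8 / θ ^ 2 * (t - s) ^ (a - 2)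
        + Real.exp (-(θ / 2) * (t - s)) * |ouCov θ (subfBmCov a) ((t + s) / 2) s| := by
  set D := (t - s) / 2 with hD
  have hD0 : 0 < D := by linarith
  have hrect : ∀ x ∈ Set.Icc ((t + s) / 2) t, ∀ u ∈ Set.Icc 0 s,
      |(subfBmCov a t s - subfBmCov a x s) - (subfBmCov a t u - subfBmCov a x u)|
        ≤ 2 * D ^ (a - 2) * (t - x) * (s - u) := fun x ⟨hpx, hxt⟩ u ⟨hu, hus⟩ => by
    have hadd := abs_le.1 (abs_add_rpow_rect_le ha0 ha hD0 (by linarith) hxt hu hus)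
    have hsub := abs_le.1 (abs_sub_rpow_rect_le ha0 ha hD0 (by linarith) hxt hus)
    simp only [subfBmCov]
    rw [abs_le]
    constructor
    · linear_combination (hadd.2 + hsub.2) / 2
    · linear_combination (hadd.1 + hsub.1) / 2
  have hbound := abs_ouCov_le_add_exp_mul hθ (by linarith) hs (by positivity)
    (continuous_subfBmCov ha0) hrect
  have hpow : 2 * D ^ (a - 2) / θ ^ 2 ≤ 8 / θ ^ 2 * (t - s) ^ (a - 2) := by
    calc 2 * D ^ (a - 2) / θ ^ 2 ≤ 2 * (4 * (t - s) ^ (a - 2)) / θ ^ 2 := by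
          gcongr
          exact half_rpow_sub_two_le ha0 (by linarith)
      _ = 8 / θ ^ 2 * (t - s) ^ (a - 2) := by ring
  rw [show -θ * (t - (t + s) / 2) = -(θ / 2) * (t - s) by ring] at hbound
  exact hbound.trans (add_le_add hpow le_rfl)

end subfBmCov

section SecondOrder

open TopologicalSpace in
lemma aemeasurable_uncurry_of_ae_continuous {Ω ι β : Type*} [MeasurableSpace Ω] {P : Measure Ω}
    [TopologicalSpace ι] [PseudoMetrizableSpace ι] [SecondCountableTopology ι]
    [MeasurableSpace ι] [OpensMeasurableSpace ι] [TopologicalSpace β] [PseudoMetrizableSpace β]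
    [MeasurableSpace β] [BorelSpace β] {g : Ω → ι → β} (hg : ∀ i, AEMeasurable (fun ω => g ω i) P)
    (hc : ∀ᵐ ω ∂P, Continuous (g ω)) (μ : Measure ι) [SFinite μ] :
    AEMeasurable (Function.uncurry g) (P.prod μ) := by
  let := pseudoMetrizableSpacePseudoMetric ι
  rcases isEmpty_or_nonempty ι with hι | hι
  · exact (measurable_of_empty _).aemeasurable
  set q : ℕ → SimpleFunc ι ℕ := SimpleFunc.nearestPtInd (denseSeq ι)
  refine aemeasurable_of_tendsto_metrizable_ae Filter.atTop
    (f := fun n z => g z.1 (denseSeq ι (q n z.2))) (fun n => ?_) ?_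
  · have hmk : Measurable fun z : Ω × ℕ => (hg (denseSeq ι z.2)).mk _ z.1 :=
      measurable_from_prod_countable_left fun k => (hg (denseSeq ι k)).measurable_mk
    refine ⟨_, hmk.comp (measurable_fst.prodMk ((q n).measurable.comp measurable_snd)), ?_⟩
    filter_upwards [Measure.quasiMeasurePreserving_fst.ae
      (ae_all_iff.2 fun k => (hg (denseSeq ι k)).ae_eq_mk)] with z hz using hz _
  · filter_upwards [Measure.quasiMeasurePreserving_fst.ae hc] with z hz
    exact (hz.tendsto z.2).comp (SimpleFunc.tendsto_nearestPt (denseRange_denseSeq ι z.2))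

variable {Ω α : Type*} [MeasurableSpace Ω] [MeasurableSpace α] {P : Measure Ω} {μ : Measure α}

lemma sq_integral_mul_le {Y Z : Ω → ℝ} (hY : MemLp Y 2 P) (hZ : MemLp Z 2 P) :
    (∫ ω, Y ω * Z ω ∂P) ^ 2 ≤ (∫ ω, Y ω ^ 2 ∂P) * ∫ ω, Z ω ^ 2 ∂P := by
  have hYZ : Integrable (fun ω => Y ω * Z ω) P := hY.integrable_mul hZ
  have hquadratic : ∀ c : ℝ, 0 ≤ (∫ ω, Z ω ^ 2 ∂P) * (c * c)
      + 2 * (∫ ω, Y ω * Z ω ∂P) * c + ∫ ω, Y ω ^ 2 ∂P := fun c => by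
    have hexpand : ∀ ω, (Y ω + c * Z ω) ^ 2
        = Z ω ^ 2 * (c * c) + Y ω * Z ω * (2 * c) + Y ω ^ 2 := fun ω => by ring
    have hnonneg : 0 ≤ ∫ ω, (Y ω + c * Z ω) ^ 2 ∂P := integral_nonneg fun ω => sq_nonneg _
    simp only [hexpand] at hnonneg
    rw [integral_add (f := fun ω => Z ω ^ 2 * (c * c) + Y ω * Z ω * (2 * c))
        ((hZ.integrable_sq.mul_const _).add (hYZ.mul_const _)) hY.integrable_sq,
      integral_add (hZ.integrable_sq.mul_const _) (hYZ.mul_const _), integral_mul_const,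
      integral_mul_const] at hnonneg
    linarith
  have hdiscrim := discrim_le_zero hquadratic
  rw [discrim] at hdiscrim
  linarith

lemma abs_integral_mul_le {Y Z : Ω → ℝ} {M : ℝ} (hY : MemLp Y 2 P) (hZ : MemLp Z 2 P)
    (hYM : ∫ ω, Y ω ^ 2 ∂P ≤ M) (hZM : ∫ ω, Z ω ^ 2 ∂P ≤ M) : |∫ ω, Y ω * Z ω ∂P| ≤ M := by
  have hZ0 : 0 ≤ ∫ ω, Z ω ^ 2 ∂P := integral_nonneg fun ω => sq_nonneg _
  refine abs_le_of_sq_le_sq ((sq_integral_mul_le hY hZ).trans ?_) (hZ0.trans hZM)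
  rw [pow_two]
  exact mul_le_mul hYM hZM hZ0 (hZ0.trans hZM)

lemma sq_integral_le [IsFiniteMeasure μ] {f : α → ℝ} (hf : MemLp f 2 μ) :
    (∫ x, f x ∂μ) ^ 2 ≤ μ.real Set.univ * ∫ x, f x ^ 2 ∂μ := by
  simpa using sq_integral_mul_le (memLp_const 1) hf

variable {g : Ω → α → ℝ}

lemma memLp_two_uncurry [SFinite P] [SFinite μ] (hm : AEMeasurable (Function.uncurry g) (P.prod μ))
    (hg : ∀ᵐ r ∂μ, MemLp (fun ω => g ω r) 2 P) (hint : Integrable (fun r => ∫ ω, g ω r ^ 2 ∂P) μ) :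
    MemLp (Function.uncurry g) 2 (P.prod μ) := by
  have hsq : AEStronglyMeasurable (fun z : Ω × α => g z.1 z.2 ^ 2) (P.prod μ) :=
    (hm.pow_const 2).aestronglyMeasurable
  rw [memLp_two_iff_integrable_sq hm.aestronglyMeasurable]
  refine (integrable_prod_iff' hsq).2 ⟨hg.mono fun r hr => hr.integrable_sq, ?_⟩
  simpa only [norm_pow, Real.norm_eq_abs, sq_abs] using hint

lemma memLp_two_integral [SFinite P] [IsFiniteMeasure μ]
    (hg : MemLp (Function.uncurry g) 2 (P.prod μ)) : MemLp (fun ω => ∫ r, g ω r ∂μ) 2 P := by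
  have hm : AEStronglyMeasurable (fun ω => ∫ r, g ω r ∂μ) P := hg.1.integral_prod_right'
  have hsq : Integrable (fun z : Ω × α => g z.1 z.2 ^ 2) (P.prod μ) := hg.integrable_sq
  rw [memLp_two_iff_integrable_sq hm]
  refine Integrable.mono' (hsq.integral_prod_left.const_mul (μ.real Set.univ)) (hm.pow 2) ?_
  filter_upwards [hsq.prod_right_ae, hg.1.prodMk_left] with ω hω hmω
  rw [Real.norm_eq_abs, abs_of_nonneg (sq_nonneg _)]
  exact sq_integral_le ((memLp_two_iff_integrable_sq hmω).2 hω)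

lemma integral_mul_integral_swap [SFinite P] [IsFiniteMeasure μ]
    (hg : MemLp (Function.uncurry g) 2 (P.prod μ)) {Z : Ω → ℝ} (hZ : MemLp Z 2 P) :
    ∫ ω, Z ω * ∫ r, g ω r ∂μ ∂P = ∫ r, ∫ ω, Z ω * g ω r ∂P ∂μ := by
  simp only [← integral_const_mul]
  exact integral_integral_swap ((hZ.comp_fst μ).integrable_mul hg)

end SecondOrder

section Langevin

/-- `h = x + θ I` with `I' = x`, and after integration by parts the contribution of `θ I` cancels
the integral term in the contribution of `x`. -/
lemma eq_ouIntegral_of_langevin {θ : ℝ} {x h : ℝ≥0 → ℝ} (hx : Continuous x) (hx0 : x 0 = 0)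
    (heq : ∀ t : ℝ≥0, x t = -θ * (∫ r in (0 : ℝ)..t, x r.toNNReal) + h t) (t : ℝ≥0) :
    x t = ouIntegral θ 0 t fun r => h r.toNNReal := by
  have hy : Continuous fun r : ℝ => x r.toNNReal := hx.comp continuous_real_toNNReal
  set I : ℝ → ℝ := fun t => ∫ r in (0 : ℝ)..t, x r.toNNReal
  have hI : ∀ r, HasDerivAt I (x r.toNNReal) r := fun r =>
    (hy.integral_hasStrictDerivAt 0 r).hasDerivAt
  have hIc : Continuous I := continuous_iff_continuousAt.2 fun r => (hI r).continuousAt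
  have hnoise : ∀ r ∈ Set.Icc (0 : ℝ) t, h r.toNNReal = x r.toNNReal + θ * I r := fun r hr => by
    rw [heq, Real.coe_toNNReal r hr.1]
    ring
  rw [ouIntegral_congr θ t.coe_nonneg hnoise, ouIntegral_add θ 0 t hy (hIc.const_mul θ),
    ouIntegral_const_mul, ouIntegral_eq_integral_deriv θ 0 t hI hy, ouIntegral,
    Real.toNNReal_coe, Real.toNNReal_zero, hx0]
  ring

variable {Ω : Type*} [MeasurableSpace Ω] {P : Measure Ω} {θ : ℝ} {G X : ℝ≥0 → Ω → ℝ}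

lemma IsLangevinSolution.ae_eq_ouIntegral (hX : IsLangevinSolution P θ G X) (t : ℝ≥0) :
    X t =ᵐ[P] fun ω => ouIntegral θ 0 t fun r => G r.toNNReal ω := by
  filter_upwards [hX.continuous, hX.init, hX.equation] with ω hc h0 heq
  exact eq_ouIntegral_of_langevin hc h0 heq t

lemma IsLangevinSolution.ae_continuous_driver (hX : IsLangevinSolution P θ G X) :
    ∀ᵐ ω ∂P, Continuous fun r : ℝ => G r.toNNReal ω := by
  filter_upwards [hX.continuous, hX.equation] with ω hc heq
  have hpath : Continuous fun r : ℝ => X r.toNNReal ω := hc.comp continuous_real_toNNReal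
  have hdriver : ∀ r : ℝ, G r.toNNReal ω
      = X r.toNNReal ω + θ * ∫ v in (0 : ℝ)..r.toNNReal, X v.toNNReal ω := fun r => by
    rw [heq]
    ring
  simp only [hdriver]
  exact hpath.add (((intervalIntegral.continuous_primitive
    (fun _ _ => hpath.intervalIntegrable _ _) 0).comp
      (NNReal.continuous_coe.comp continuous_real_toNNReal)).const_mul θ)

lemma IsLangevinSolution.aemeasurable_uncurry_driver (hX : IsLangevinSolution P θ G X)
    (hG : ∀ t, AEMeasurable (G t) P) (μ : Measure ℝ) [SFinite μ] :
    AEMeasurable (Function.uncurry fun ω (r : ℝ) => G r.toNNReal ω) (P.prod μ) :=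
  aemeasurable_uncurry_of_ae_continuous (fun r => hG r.toNNReal)
    hX.ae_continuous_driver μ

end Langevin

section OUCovariance

variable {Ω : Type*} [MeasurableSpace Ω] {P : Measure Ω} [SFinite P] {θ p t : ℝ}

section ouIntegral

variable {g : Ω → ℝ → ℝ}
  (hm : AEMeasurable (Function.uncurry g) (P.prod (volume.restrict (Set.Ioc p t))))
  (hg : ∀ r, MemLp (fun ω => g ω r) 2 P) (hc : Continuous fun r => ∫ ω, g ω r ^ 2 ∂P)

include hm hg hc

lemma memLp_two_uncurry_exp_mul :
    MemLp (Function.uncurry fun ω r => Real.exp (-θ * (t - r)) * g ω r) 2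
      (P.prod (volume.restrict (Set.Ioc p t))) := by
  have hkernel : Measurable fun z : Ω × ℝ => Real.exp (-θ * (t - z.2)) := by fun_prop
  refine memLp_two_uncurry (hkernel.aemeasurable.mul hm) (.of_forall fun r => (hg r).const_mul _) ?_
  simp only [mul_pow, integral_const_mul]
  exact (Continuous.integrableOn_Icc (by fun_prop)).mono_set Set.Ioc_subset_Icc_self

lemma memLp_two_ouIntegral (hpt : p ≤ t) : MemLp (fun ω => ouIntegral θ p t (g ω)) 2 P := by
  simp only [ouIntegral, intervalIntegral.integral_of_le hpt]
  exact ((hg t).sub ((hg p).const_mul _)).sub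
    ((memLp_two_integral (memLp_two_uncurry_exp_mul hm hg hc)).const_mul θ)

lemma integral_mul_ouIntegral (hpt : p ≤ t) {Z : Ω → ℝ} (hZ : MemLp Z 2 P) :
    ∫ ω, Z ω * ouIntegral θ p t (g ω) ∂P = ouIntegral θ p t fun r => ∫ ω, Z ω * g ω r ∂P := by
  have hprod := memLp_two_uncurry_exp_mul (θ := θ) hm hg hc
  have hZt : Integrable (fun ω => Z ω * g ω t) P := hZ.integrable_mul (hg t)
  have hZp : Integrable (fun ω => Z ω * g ω p) P := hZ.integrable_mul (hg p)
  have hZint : Integrable (fun ω => Z ω * ∫ r in Set.Ioc p t, Real.exp (-θ * (t - r)) * g ω r) P :=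
    hZ.integrable_mul (memLp_two_integral hprod)
  simp only [ouIntegral, intervalIntegral.integral_of_le hpt, mul_sub (Z _), mul_left_comm (Z _)]
  rw [integral_sub (f := fun ω => Z ω * g ω t - Real.exp (-θ * (t - p)) * (Z ω * g ω p))
    (hZt.sub (hZp.const_mul _)) (hZint.const_mul θ), integral_sub hZt (hZp.const_mul _),
    integral_const_mul, integral_const_mul, integral_mul_integral_swap hprod hZ]
  simp only [mul_left_comm (Z _), integral_const_mul]

end ouIntegral

namespace IsLangevinSolution

variable {G X : ℝ≥0 → Ω → ℝ} (hX : IsLangevinSolution P θ G X) (hG : ∀ t, MemLp (G t) 2 P)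
  (hc : Continuous fun t => ∫ ω, G t ω ^ 2 ∂P)

include hX hG hc

lemma memLp_two (t : ℝ≥0) : MemLp (X t) 2 P :=
  (memLp_congr_ae (hX.ae_eq_ouIntegral t)).2 (memLp_two_ouIntegral
    (hX.aemeasurable_uncurry_driver (fun r => (hG r).aemeasurable) _)
    (fun r => hG r.toNNReal) (hc.comp continuous_real_toNNReal) t.coe_nonneg)

lemma integral_mul_eq_ouIntegral {Z : Ω → ℝ} (hZ : MemLp Z 2 P) (t : ℝ≥0) :
    ∫ ω, Z ω * X t ω ∂P = ouIntegral θ 0 t fun r => ∫ ω, Z ω * G r.toNNReal ω ∂P := by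
  rw [integral_congr_ae ((hX.ae_eq_ouIntegral t).mono fun ω hω => congrArg (Z ω * ·) hω)]
  exact integral_mul_ouIntegral
    (hX.aemeasurable_uncurry_driver (fun r => (hG r).aemeasurable) _)
    (fun r => hG r.toNNReal) (hc.comp continuous_real_toNNReal) t.coe_nonneg hZ

lemma integral_mul_eq_ouCov (t s : ℝ≥0) :
    ∫ ω, X t ω * X s ω ∂P
      = ouCov θ (fun x y => ∫ ω, G x.toNNReal ω * G y.toNNReal ω ∂P) t s := by
  simp only [mul_comm (X t _)]
  rw [hX.integral_mul_eq_ouIntegral hG hc (hX.memLp_two hG hc s), ouCov]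
  simp only [mul_comm (X s _), hX.integral_mul_eq_ouIntegral hG hc (hG _)]

end IsLangevinSolution

end OUCovariance

/-- `S` is a second-order process with the second moments `E (S_t S_s)` of the sub-fractional
Brownian motion with parameter `H`. -/
structure HasSubfBmCovariance {Ω : Type*} [MeasurableSpace Ω] (P : Measure Ω) (H : ℝ)
    (S : ℝ≥0 → Ω → ℝ) : Prop where
  memLp_two : ∀ t, MemLp (S t) 2 P
  integral_mul : ∀ t s : ℝ≥0, ∫ ω, S t ω * S s ω ∂P = subfBmCov (2 * H) t s

section SubfBm

variable {Ω : Type*} [MeasurableSpace Ω] {P : Measure Ω} {H θ : ℝ} {S X : ℝ≥0 → Ω → ℝ}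

lemma IsSubfBm.hasSubfBmCovariance (hS : IsSubfBm P H S) : HasSubfBmCovariance P H S where
  memLp_two t := (hS.gaussian.hasGaussianLaw_eval t).memLp_two
  integral_mul t s := by
    rw [hS.covariance, subfBmCov, NNReal.abs_eq, NNReal.abs_eq, ← NNReal.coe_add, NNReal.abs_eq]

lemma HasStationaryIncrements.integral_sub_sq {G : ℝ≥0 → Ω → ℝ} (hG : HasStationaryIncrements P G)
    (t s : ℝ≥0) : ∫ ω, (G (t + s) ω - G s ω) ^ 2 ∂P = ∫ ω, (G t ω - G 0 ω) ^ 2 ∂P := by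
  have hsq : Measurable fun f : ({t} : Finset ℝ≥0) → ℝ => f ⟨t, Finset.mem_singleton_self t⟩ ^ 2 :=
    (measurable_pi_apply _).pow_const 2
  exact ((hG s {t}).comp hsq).integral_eq

namespace HasSubfBmCovariance

variable (hS : HasSubfBmCovariance P H S)

include hS

lemma integral_increment_sq (hH : H ≠ 0) (s : ℝ≥0) :
    ∫ ω, (S (1 + s) ω - S s ω) ^ 2 ∂P
      = 1 - ((|(2 * s + 1 + 1 : ℝ)| ^ (2 * H) - |(2 * s + 1 : ℝ)| ^ (2 * H))
        - (|(2 * s + 1 : ℝ)| ^ (2 * H) - |(2 * s : ℝ)| ^ (2 * H))) / 2 := by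
  have hint : ∀ t u, Integrable (fun ω => S t ω * S u ω) P := fun t u =>
    (hS.memLp_two t).integrable_mul (hS.memLp_two u)
  have hexpand : ∀ ω, (S (1 + s) ω - S s ω) ^ 2
      = S (1 + s) ω * S (1 + s) ω - 2 * (S (1 + s) ω * S s ω) + S s ω * S s ω := fun ω => by ring
  simp only [hexpand]
  rw [integral_add (f := fun ω => S (1 + s) ω * S (1 + s) ω - 2 * (S (1 + s) ω * S s ω))
    ((hint _ _).sub ((hint _ _).const_mul 2)) (hint _ _),
    integral_sub (hint _ _) ((hint _ _).const_mul 2), integral_const_mul]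
  have h2H : 2 * H ≠ 0 := mul_ne_zero two_ne_zero hH
  have hadd : (1 + s + (1 + s) : ℝ) = 2 * s + 1 + 1 ∧ (1 + s + s : ℝ) = 2 * s + 1
      ∧ (s + s : ℝ) = 2 * s := ⟨by ring, by ring, by ring⟩
  simp only [hS.integral_mul, subfBmCov, NNReal.coe_add, NNReal.coe_one, hadd, sub_self,
    add_sub_cancel_right, abs_zero, abs_one, Real.zero_rpow h2H, Real.one_rpow]
  ring

lemma abs_integral_increment_sq_sub_one_le (hH0 : 0 < H) (hH1 : H ≤ 1) {s : ℝ≥0} (hs : 0 < s) :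
    |∫ ω, (S (1 + s) ω - S s ω) ^ 2 ∂P - 1| ≤ (2 * s : ℝ) ^ (2 * H - 2) := by
  have hs' : (0 : ℝ) < 2 * s := by positivity
  have h := abs_rpow_second_difference_le (a := 2 * H) (x := 2 * s) (y := 2 * s + 1) (k := 1)
    (by linarith) (by linarith) hs' le_rfl (by linarith) zero_le_one
  rw [add_sub_cancel_left, abs_one] at h
  rw [hS.integral_increment_sq hH0.ne', sub_sub_cancel_left, abs_neg, abs_div, abs_two]
  linarith

/-- The increments over `[s, s + 1]` have asymptotic variance `1`, that over `[0, 1]` has variance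
`2 - 2 ^ (2 * H) / 2`. -/
lemma not_hasStationaryIncrements (hH0 : 0 < H) (hH1 : H < 1) (hH : H ≠ 1 / 2) :
    ¬ HasStationaryIncrements P S := fun hstat => by
  set v := ∫ ω, (S 1 ω - S 0 ω) ^ 2 ∂P
  have hv : v = 2 - 2 ^ (2 * H) / 2 := by
    have h := hS.integral_increment_sq hH0.ne' 0
    have h2H : 2 * H ≠ 0 := mul_ne_zero two_ne_zero hH0.ne'
    norm_num [Real.zero_rpow h2H] at h
    linarith
  have hbound : ∀ r : ℝ, 0 < r → |v - 1| ≤ r ^ (-(2 - 2 * H)) := fun r hr => by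
    have h := hS.abs_integral_increment_sq_sub_one_le hH0 hH1.le (s := (r / 2).toNNReal)
      (Real.toNNReal_pos.2 (half_pos hr))
    rwa [hstat.integral_sub_sq, Real.coe_toNNReal _ (half_pos hr).le, mul_div_cancel₀ r two_ne_zero,
      ← neg_sub 2] at h
  have hv1 : |v - 1| ≤ 0 := ge_of_tendsto (tendsto_rpow_neg_atTop (by linarith))
    ((Filter.eventually_gt_atTop 0).mono hbound)
  have hpow : (2 : ℝ) ^ (2 * H) = 2 ^ (1 : ℝ) := by
    rw [Real.rpow_one]
    linarith [abs_nonpos_iff.1 hv1]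
  exact hH (by linarith [(Real.rpow_right_inj two_pos (by norm_num)).1 hpow])

lemma continuous_integral_sq (hH : 0 ≤ H) : Continuous fun t => ∫ ω, S t ω ^ 2 ∂P := by
  simp only [pow_two, hS.integral_mul]
  exact (continuous_subfBmCov (by linarith)).comp
    (NNReal.continuous_coe.prodMk NNReal.continuous_coe)

variable [SFinite P] (hX : IsLangevinSolution P θ S X)

include hX

lemma langevin_memLp_two (hH : 0 ≤ H) (t : ℝ≥0) : MemLp (X t) 2 P :=
  hX.memLp_two hS.memLp_two (hS.continuous_integral_sq hH) t

lemma langevin_integral_mul (hH : 0 ≤ H) (t s : ℝ≥0) :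
    ∫ ω, X t ω * X s ω ∂P = ouCov θ (subfBmCov (2 * H)) t s := by
  rw [hX.integral_mul_eq_ouCov hS.memLp_two (hS.continuous_integral_sq hH)]
  refine ouCov_congr θ t.coe_nonneg s.coe_nonneg fun x hx y hy => ?_
  rw [hS.integral_mul, Real.coe_toNNReal x hx, Real.coe_toNNReal y hy]

lemma abs_langevin_integral_mul_le {M : ℝ} (hH0 : 0 ≤ H) (hH1 : H ≤ 1) (hθ : 0 < θ)
    (hM : ∀ t : ℝ, 0 ≤ t → |ouCov θ (subfBmCov (2 * H)) t t| ≤ M) {t s : ℝ≥0} (hts : t ≠ s) :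
    |∫ ω, X t ω * X s ω ∂P|
      ≤ (8 / θ ^ 2 + (1 + 8 / θ ^ 2) * M) * |(t : ℝ) - s| ^ (2 * H - 2) := by
  wlog hst : s < t generalizing t s
  · simpa only [abs_sub_comm, mul_comm] using this hts.symm (hts.lt_of_le (not_lt.1 hst))
  have hst' : (s : ℝ) < t := NNReal.coe_lt_coe.2 hst
  have hcov := hS.langevin_integral_mul hX hH0
  have hmem := hS.langevin_memLp_two hX hH0
  have hvar : ∀ u : ℝ≥0, ∫ ω, X u ω ^ 2 ∂P ≤ M := fun u => by
    simp only [pow_two, hcov]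
    exact (le_abs_self _).trans (hM u u.coe_nonneg)
  have hpast : |ouCov θ (subfBmCov (2 * H)) ((t + s) / 2) s| ≤ M := by
    have h := abs_integral_mul_le (hmem ((t + s) / 2)) (hmem s) (hvar _) (hvar _)
    rwa [hcov, NNReal.coe_div, NNReal.coe_add, NNReal.coe_two] at h
  have hexp : Real.exp (-(θ / 2) * (t - s)) ≤ (1 + 8 / θ ^ 2) * (t - s : ℝ) ^ (2 * H - 2) := by
    have h := exp_neg_mul_le_rpow (a := 2 * H) (by linarith) (by linarith) (half_pos hθ)
      (sub_pos.2 hst')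
    rwa [show 2 / (θ / 2) ^ 2 = 8 / θ ^ 2 by ring] at h
  rw [hcov, abs_of_pos (sub_pos.2 hst')]
  calc |ouCov θ (subfBmCov (2 * H)) t s|
      ≤ 8 / θ ^ 2 * (t - s : ℝ) ^ (2 * H - 2) + Real.exp (-(θ / 2) * (t - s)) *
          |ouCov θ (subfBmCov (2 * H)) ((t + s) / 2) s| :=
        abs_ouCov_subfBmCov_le_add_exp_mul (by linarith) (by linarith) hθ s.coe_nonneg hst'
    _ ≤ 8 / θ ^ 2 * (t - s : ℝ) ^ (2 * H - 2)
        + (1 + 8 / θ ^ 2) * (t - s : ℝ) ^ (2 * H - 2) * M := by gcongr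
    _ = (8 / θ ^ 2 + (1 + 8 / θ ^ 2) * M) * (t - s : ℝ) ^ (2 * H - 2) := by ring

end HasSubfBmCovariance

end SubfBm

theorem theorem4p2_general (H θ : ℝ) (hH0 : 0 < H) (hH1 : H < 1) (hθ : 0 < θ) :
    ∃ C : ℝ, 0 < C ∧
      ∀ (Ω : Type*) [MeasurableSpace Ω] (P : Measure Ω) [SFinite P] (S X : ℝ≥0 → Ω → ℝ),
        HasSubfBmCovariance P H S → IsLangevinSolution P θ S X →
          (H ≠ 1 / 2 → ¬ HasStationaryIncrements P S) ∧
          (∀ t : ℝ≥0, MemLp (X t) 2 P) ∧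
          (∀ t : ℝ≥0, 0 < t →
            |(∫ ω, X t ω ^ 2 ∂P) - H * Real.Gamma (2 * H) / θ ^ (2 * H)|
              ≤ C * (t : ℝ) ^ (2 * H - 2)) ∧
          (∀ t s : ℝ≥0, t ≠ s →
            |∫ ω, X t ω * X s ω ∂P| ≤ C * |(t : ℝ) - s| ^ (2 * H - 2)) := by
  obtain ⟨M, hM0, hM⟩ := exists_abs_ouCov_subfBmCov_le (a := 2 * H) (by linarith) (by linarith) hθ
  refine ⟨72 / θ ^ 2 + (8 / θ ^ 2 + (1 + 8 / θ ^ 2) * M), by positivity,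
    fun Ω _ P _ S X hS hX => ⟨hS.not_hasStationaryIncrements hH0 hH1,
      hS.langevin_memLp_two hX hH0.le, fun t ht => ?_, fun t s hts => ?_⟩⟩
  · have hvariance := abs_ouCov_subfBmCov_sub_le (a := 2 * H) (by linarith) (by linarith) hθ
      (NNReal.coe_pos.2 ht)
    rw [mul_div_cancel_left₀ H two_ne_zero, ← hS.langevin_integral_mul hX hH0.le] at hvariance
    simp only [pow_two (X t _)]
    refine hvariance.trans ?_
    exact mul_le_mul_of_nonneg_right (le_add_of_nonneg_right (by positivity)) (by positivity)
  · refine (hS.abs_langevin_integral_mul_le hX hH0.le hH1.le hθ hM hts).trans ?_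
    exact mul_le_mul_of_nonneg_right (le_add_of_nonneg_left (by positivity)) (by positivity)

theorem theorem4p2 (H θ : ℝ) (hH0 : 0 < H) (hH1 : H < 1) (hH : H ≠ 1 / 2) (hθ : 0 < θ) :
    ∃ C : ℝ, 0 < C ∧
      ∀ (Ω : Type*) [MeasurableSpace Ω] (P : Measure Ω) [IsProbabilityMeasure P]
        (S X : ℝ≥0 → Ω → ℝ),
        IsSubfBm P H S → IsLangevinSolution P θ S X →
          ¬ HasStationaryIncrements P S ∧
          (∀ t : ℝ≥0, MemLp (X t) 2 P) ∧
          (∀ t : ℝ≥0, 2 < t →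
            |(∫ ω, X t ω ^ 2 ∂P) - H * Real.Gamma (2 * H) / θ ^ (2 * H)|
              ≤ C * (t : ℝ) ^ (2 * H - 2)) ∧
          (∀ t s : ℝ≥0, 2 < |(t : ℝ) - s| →
            ∫ ω, X t ω * X s ω ∂P ≤ C * |(t : ℝ) - s| ^ (2 * H - 2)) := by
  obtain ⟨C, hC0, hC⟩ := theorem4p2_general H θ hH0 hH1 hθ
  refine ⟨C, hC0, fun Ω _ P _ S X hS hX => ?_⟩
  obtain ⟨hstat, hmem, hvar, hcov⟩ := hC Ω P S X hS.hasSubfBmCovariance hX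
  exact ⟨hstat hH, hmem, fun t ht => hvar t (ht.trans' two_pos), fun t s hts =>
    (le_abs_self _).trans (hcov t s fun hts_eq => by norm_num [hts_eq] at hts)⟩
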